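/- Let $H$ be a real inner product space (the feature space $\mathbb{R}^{d_2}$, where $d_2$ may be infinite), $\phi:\mathbb{R}^{d_1}\to H$ a feature map with kernel $\mathcal{K}(u,v)=\langle\phi(u),\phi(v)\rangle$, and $z_1,\dots,z_p:\mathbb{R}^{d_0}\to\mathbb{R}^{d_1}$ the patch maps. A matrix with rows indexed by $H$ is the finite list of its columns in $H$ (equivalently, a linear map from a Euclidean space to $H$), and $F^\top G$ denotes the matrix of inner products of the columns of $F$ and $G$. For $x,x'\in\mathbb{R}^{d_0}$ let $\Phi(x)=[\phi(z_1(x)),\dots,\phi(z_p(x))]$ and $K(x,x')=\Phi(x)^\top\Phi(x')=\big(\mathcal{K}(z_k(x),z_l(x'))\big)_{k,l=1}^p$. Let $(\mathbf{x}_i,y_i)$, $i=1,\dots,n$, be training samples with $\mathbf{x}_i\in\mathbb{R}^{d_0}$ and real labels $y_i$ (for binary classification, $y_i\in\{-1,1\}$), let $c>0$, and let $\ell:\mathbb{R}\to\mathbb{R}$ be convex and non-increasing. Let $(\hat A,\hat\xi)$ be an optimal solution of the primal problem $$\min_{A,\,\xi}\ \|A\|_*+c\sum_{i=1}^n\ell(\xi_i)\quad\text{subject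 to}\quad y_i\operatorname{Tr}\big(\Phi(\mathbf{x}_i)^\top A\big)\ge\xi_i,\quad i=1,\dots,n,$$ where $A$ ranges over all matrices with $p$ columns in $H$, $\xi$ ranges over $\mathbb{R}^n$, and $\|\cdot\|_*$ is the nuclear norm. Let $\hat A=\hat U_1\hat D_1\hat V_1^\top$ be a compact singular value decomposition: $\hat U_1$ has $r$ orthonormal columns in $H$, $\hat V_1\in\mathbb{R}^{p\times r}$ has orthonormal columns, and $\hat D_1$ is diagonal with positive diagonal entries (so $r=\operatorname{rank}\hat A$). Here $\hat U_1$ is the convolutional weight and $\hat V_1$ the linear weight. Let $\hat\alpha$ be an optimal solution of the dual problem $$\max_{\alpha\in\mathbb{R}^n}\ -c\sum_{i=1}^n\ell^*\!\left(-\frac{\alpha_i}{c}\right)\quad\text{subject to}\quad \Big\|\sum_{i=1}^n\alpha_i y_i\Phi(\mathbf{x}_i)\Big\|_2\le 1,\qquad \alpha_i\ge 0,\quad i=1,\dots,n,$$ where $\ell^*(s)=\sup_{\xi\in\mathbb{R}}(s\xi-\ell(\xi))\in(-\infty,\infty]$ is the Fenchel conjugate and $\|\cdot\|_2$ is the spectral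 norm. Then for every $i\in\{1,\dots,n\}$, $$\Phi(\mathbf{x}_i)^\top\hat U_1=\sum_{j=1}^n\hat\alpha_j\,y_j\,K(\mathbf{x}_i,\mathbf{x}_j)\,\hat V_1 .$$ -/

import Mathlib

open scoped RealInnerProductSpace

noncomputable section

namespace DCCNN

variable {H : Type*} [NormedAddCommGroup H] [InnerProductSpace ℝ H]

/- The feature space `ℝ^{d₂}`, where `d₂` may be infinite, is a real inner product space `H`.
A matrix with `q` columns and rows indexed by the feature space (a `d₂ × q` matrix) is the family
`Fin q → H` of its columns. -/

/-- The matrix product `Fᵀ G` of a `d₂ × p` and a `d₂ × q` matrix: its entries are the inner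
products of the columns. -/
def tmul {p q : ℕ} (F : Fin p → H) (G : Fin q → H) : Matrix (Fin p) (Fin q) ℝ :=
  Matrix.of fun k l => ⟪F k, G l⟫

/-- The matrix product `F M` of a `d₂ × p` matrix and an ordinary `p × q` matrix. -/
def rmul {p q : ℕ} (F : Fin p → H) (M : Matrix (Fin p) (Fin q) ℝ) : Fin q → H :=
  fun l => ∑ k, M k l • F k

/-- The linear map `ℝ^p → H`, `v ↦ F v`, between Euclidean spaces. -/
def toCLM {p : ℕ} (F : Fin p → H) : EuclideanSpace ℝ (Fin p) →L[ℝ] H :=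
  ∑ k, (EuclideanSpace.proj k : EuclideanSpace ℝ (Fin p) →L[ℝ] ℝ).smulRight (F k)

/-- The spectral norm `‖F‖₂`, i.e. the operator norm of `v ↦ F v`. -/
def spectralNorm {p : ℕ} (F : Fin p → H) : ℝ := ‖toCLM F‖

/-- `Fᵀ F` is a symmetric matrix. -/
theorem tmul_self_isHermitian {p : ℕ} (F : Fin p → H) : (tmul F F).IsHermitian := by
  ext k l
  simp [tmul, real_inner_comm]

/-- The nuclear norm `‖F‖_*`: the sum of the singular values of `F`, which are the square roots
of the eigenvalues of `Fᵀ F`. -/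
def nuclearNorm {p : ℕ} (F : Fin p → H) : ℝ :=
  ∑ k, √((tmul_self_isHermitian F).eigenvalues k)

/-- `A = U₁ D₁ V₁ᵀ` is a compact singular value decomposition, `D₁ = diag(σ)`: the columns of `U₁`
and those of `V₁` are orthonormal and the `r` diagonal entries of `D₁` are positive (so that `r` is
the rank of `A`). -/
structure IsCompactSVD {p r : ℕ} (A : Fin p → H) (U₁ : Fin r → H) (σ : Fin r → ℝ)
    (V₁ : Matrix (Fin p) (Fin r) ℝ) : Prop where
  left_orthonormal : tmul U₁ U₁ = 1
  right_orthonormal : V₁.transpose * V₁ = 1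
  pos : ∀ k, 0 < σ k
  eq_mul : A = rmul U₁ (Matrix.diagonal σ * V₁.transpose)

variable {d₀ d₁ p n : ℕ}

/-- The basis function matrix `Φ(x) = [φ(z₁(x)), …, φ(z_p(x))]`, where `z₁(x), …, z_p(x)` are the
patches of `x`. -/
def basisMatrix (φ : (Fin d₁ → ℝ) → H) (z : Fin p → (Fin d₀ → ℝ) → (Fin d₁ → ℝ))
    (x : Fin d₀ → ℝ) : Fin p → H :=
  fun k => φ (z k x)

/-- The kernel function `𝒦(u, v) = φ(u)ᵀ φ(v)`. -/
def kernelFun (φ : (Fin d₁ → ℝ) → H) (u v : Fin d₁ → ℝ) : ℝ := ⟪φ u, φ v⟫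

/-- The kernel generating matrix `K(x, x')`, with entries `𝒦(z_k(x), z_l(x'))`. -/
def kernelMatrix (𝒦 : (Fin d₁ → ℝ) → (Fin d₁ → ℝ) → ℝ)
    (z : Fin p → (Fin d₀ → ℝ) → (Fin d₁ → ℝ)) (x x' : Fin d₀ → ℝ) : Matrix (Fin p) (Fin p) ℝ :=
  Matrix.of fun k l => 𝒦 (z k x) (z l x')

/-- The feasible set of the primal problem, for the matrices `Φ i = Φ(xᵢ)`: all `(A, ξ)` with
`yᵢ Tr(Φ(xᵢ)ᵀ A) ≥ ξᵢ` for all `i`. -/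
def primalFeasible (Φ : Fin n → Fin p → H) (y : Fin n → ℝ) :
    Set ((Fin p → H) × (Fin n → ℝ)) :=
  {q | ∀ i, q.2 i ≤ y i * (tmul (Φ i) q.1).trace}

/-- The primal objective `‖A‖_* + c ∑ᵢ ℓ(ξᵢ)`. -/
def primalObjective (c : ℝ) (ℓ : ℝ → ℝ) (q : (Fin p → H) × (Fin n → ℝ)) : ℝ :=
  nuclearNorm q.1 + c * ∑ i, ℓ (q.2 i)

/-- `(A, ξ)` is an optimal solution of the primal problem. -/
def IsPrimalOptimal (Φ : Fin n → Fin p → H) (y : Fin n → ℝ) (c : ℝ) (ℓ : ℝ → ℝ)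
    (A : Fin p → H) (ξ : Fin n → ℝ) : Prop :=
  (A, ξ) ∈ primalFeasible Φ y ∧ IsMinOn (primalObjective c ℓ) (primalFeasible Φ y) (A, ξ)

/-- The Fenchel conjugate `ℓ^*(s) = sup_ξ (s ξ - ℓ(ξ))`, with values in `[-∞, ∞]`. -/
def fenchelConj (ℓ : ℝ → ℝ) (s : ℝ) : EReal :=
  ⨆ ξ : ℝ, ((s * ξ - ℓ ξ : ℝ) : EReal)

/-- The feasible set of the dual problem: all `α` with `‖∑ᵢ αᵢ yᵢ Φ(xᵢ)‖₂ ≤ 1` and `αᵢ ≥ 0`. -/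
def dualFeasible (Φ : Fin n → Fin p → H) (y : Fin n → ℝ) : Set (Fin n → ℝ) :=
  {α | spectralNorm (∑ i, (α i * y i) • Φ i) ≤ 1 ∧ ∀ i, 0 ≤ α i}

/-- The dual objective `-c ∑ᵢ ℓ^*(-αᵢ / c)`. -/
def dualObjective (c : ℝ) (ℓ : ℝ → ℝ) (α : Fin n → ℝ) : EReal :=
  -((c : EReal) * ∑ i, fenchelConj ℓ (-(α i / c)))

/-- `α` is an optimal solution of the dual problem. -/
def IsDualOptimal (Φ : Fin n → Fin p → H) (y : Fin n → ℝ) (c : ℝ) (ℓ : ℝ → ℝ)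
    (α : Fin n → ℝ) : Prop :=
  α ∈ dualFeasible Φ y ∧ IsMaxOn (dualObjective c ℓ) (dualFeasible Φ y) α

end DCCNN

end

/-! Put `M = ∑ⱼ αⱼ yⱼ Φ(xⱼ)`, so `‖M‖₂ ≤ 1` by dual feasibility. The claim is `U₁ = M V₁` multiplied
on the left by `Φ(xᵢ)ᵀ`, and this identity is the equality case of the duality between spectral and
nuclear norm.

Strong duality (`IsPrimalOptimal.exists_dualFeasible`) and complementary slackness
(`IsDualOptimal.nuclearNorm_le_trace`) give `‖A‖_* ≤ Tr(Mᵀ A)`. Writing `uⱼ`, `vⱼ` for the columns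
of `U₁`, `V₁`, one gets `∑ σⱼ ≤ ‖A‖_* ≤ ∑ σⱼ ⟪M vⱼ, uⱼ⟫`. Each inner product is at most 1 and each
`σⱼ > 0`, so all of them equal 1, which forces `M vⱼ = uⱼ` (`IsCompactSVD.toCLM_right_eq_left`).

Strong duality comes from Hahn–Banach separation (`exists_multiplier`). No Slater condition is
needed, since the loss is finite and continuous everywhere. -/

namespace DCCNN

open scoped RealInnerProductSpace

/-! ### Duality of the spectral and nuclear norms. -/

section NuclearNorm

variable {H : Type*} [NormedAddCommGroup H] [InnerProductSpace ℝ H] {p : ℕ}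

theorem toCLM_apply (F : Fin p → H) (v : EuclideanSpace ℝ (Fin p)) :
    toCLM F v = ∑ k, v k • F k := by
  simp [toCLM]

theorem trace_tmul (F G : Fin p → H) : (tmul F G).trace = ∑ k, ⟪F k, G k⟫ := by
  simp [tmul, Matrix.trace]

/-- The matrix `∑ⱼ gⱼ vⱼᵀ`. -/
def rankOneSum {ι : Type*} [Fintype ι] (g : ι → H) (v : ι → EuclideanSpace ℝ (Fin p)) :
    Fin p → H :=
  fun k => ∑ j, v j k • g j

theorem toCLM_rankOneSum {ι : Type*} [Fintype ι] (g : ι → H)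
    (v : ι → EuclideanSpace ℝ (Fin p)) (x : EuclideanSpace ℝ (Fin p)) :
    toCLM (rankOneSum g v) x = ∑ j, ⟪v j, x⟫ • g j := by
  simp only [toCLM_apply, rankOneSum, Finset.smul_sum, PiLp.inner_apply, Finset.sum_smul]
  rw [Finset.sum_comm]
  simp [smul_smul]

theorem trace_tmul_rankOneSum {ι : Type*} [Fintype ι] (F : Fin p → H) (g : ι → H)
    (v : ι → EuclideanSpace ℝ (Fin p)) :
    (tmul F (rankOneSum g v)).trace = ∑ j, ⟪toCLM F (v j), g j⟫ := by
  simp only [trace_tmul, rankOneSum, toCLM_apply, inner_sum, sum_inner, inner_smul_left,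
    inner_smul_right]
  rw [Finset.sum_comm]
  simp

theorem eq_rankOneSum (F : Fin p → H) {ι : Type*} [Fintype ι]
    (b : OrthonormalBasis ι ℝ (EuclideanSpace ℝ (Fin p))) :
    F = rankOneSum (fun j => toCLM F (b j)) b := by
  classical
  funext k
  have h := congrArg (toCLM F) (b.sum_repr' (EuclideanSpace.single k (1 : ℝ)))
  rw [map_sum] at h
  simpa [rankOneSum, toCLM_apply, ite_smul, Pi.single_apply, EuclideanSpace.inner_single_right]
    using h.symm

/-- Pythagoras for the `g j`, then Bessel for the `v j`. The `g j` are not assumed to be unit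
vectors, so that some may vanish. -/
theorem norm_rankOneSum_le_one {ι : Type*} [Fintype ι] (g : ι → H)
    (v : ι → EuclideanSpace ℝ (Fin p)) (hv : Orthonormal ℝ v)
    (hg : ∀ i j, i ≠ j → ⟪g i, g j⟫ = 0) (hg1 : ∀ i, ‖g i‖ ≤ 1) :
    ‖toCLM (rankOneSum g v)‖ ≤ 1 := by
  classical
  refine ContinuousLinearMap.opNorm_le_bound _ zero_le_one fun x => ?_
  rw [one_mul, ← sq_le_sq₀ (norm_nonneg _) (norm_nonneg _)]
  calc ‖toCLM (rankOneSum g v) x‖ ^ 2 = ∑ j, ⟪v j, x⟫ ^ 2 * ‖g j‖ ^ 2 := by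
        rw [toCLM_rankOneSum, ← real_inner_self_eq_norm_sq]
        simp only [sum_inner, inner_sum, inner_smul_left, inner_smul_right]
        refine Finset.sum_congr rfl fun i _ => ?_
        rw [Finset.sum_eq_single i]
        · rw [real_inner_self_eq_norm_sq]; simp; ring
        · intro j _ hj
          simp [hg j i hj]
        · simp
    _ ≤ ∑ j, ‖⟪v j, x⟫‖ ^ 2 := by
        refine Finset.sum_le_sum fun j _ => ?_
        rw [Real.norm_eq_abs, sq_abs]
        exact mul_le_of_le_one_right (sq_nonneg _) (pow_le_one₀ (norm_nonneg _) (hg1 j))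
    _ ≤ ‖x‖ ^ 2 := hv.sum_inner_products_le x

/-- The right singular vectors of `F`. -/
noncomputable def rightSingular (F : Fin p → H) : OrthonormalBasis (Fin p) ℝ (EuclideanSpace ℝ (Fin p)) :=
  (tmul_self_isHermitian F).eigenvectorBasis

theorem inner_toCLM_toCLM (F : Fin p → H) (v w : EuclideanSpace ℝ (Fin p)) :
    ⟪toCLM F v, toCLM F w⟫ = v.ofLp ⬝ᵥ (tmul F F).mulVec w.ofLp := by
  simp only [toCLM_apply, sum_inner, inner_sum, inner_smul_left, inner_smul_right, dotProduct,
    Matrix.mulVec, tmul, Matrix.of_apply, Finset.mul_sum]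
  rw [Finset.sum_comm]
  refine Finset.sum_congr rfl fun i _ => Finset.sum_congr rfl fun j _ => ?_
  simp
  ring

theorem inner_toCLM_rightSingular (F : Fin p → H) (i j : Fin p) :
    ⟪toCLM F (rightSingular F i), toCLM F (rightSingular F j)⟫ =
      if i = j then (tmul_self_isHermitian F).eigenvalues j else 0 := by
  have h := orthonormal_iff_ite.1 (rightSingular F).orthonormal i j
  rw [inner_toCLM_toCLM, rightSingular, Matrix.IsHermitian.mulVec_eigenvectorBasis,
    dotProduct_smul]
  have h2 : ⟪rightSingular F i, rightSingular F j⟫ =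
      (rightSingular F i).ofLp ⬝ᵥ (rightSingular F j).ofLp := by
    simp [PiLp.inner_apply, dotProduct, mul_comm]
  rw [h2, rightSingular] at h
  rw [h]
  split_ifs <;> simp

theorem norm_toCLM_rightSingular (F : Fin p → H) (k : Fin p) :
    ‖toCLM F (rightSingular F k)‖ = √((tmul_self_isHermitian F).eigenvalues k) := by
  have h := inner_toCLM_rightSingular F k k
  rw [if_pos rfl, real_inner_self_eq_norm_sq] at h
  rw [← h, Real.sqrt_sq (norm_nonneg _)]

theorem nuclearNorm_eq_sum_norm (F : Fin p → H) :
    nuclearNorm F = ∑ k, ‖toCLM F (rightSingular F k)‖ := by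
  simp [nuclearNorm, norm_toCLM_rightSingular]

theorem nuclearNorm_nonneg (F : Fin p → H) : 0 ≤ nuclearNorm F :=
  Finset.sum_nonneg fun _ _ => Real.sqrt_nonneg _

/-- The spectral norm and the nuclear norm are in duality. -/
theorem trace_tmul_le_nuclearNorm (M F : Fin p → H) (hM : ‖toCLM M‖ ≤ 1) :
    (tmul M F).trace ≤ nuclearNorm F := by
  conv_lhs => rw [eq_rankOneSum F (rightSingular F)]
  rw [trace_tmul_rankOneSum, nuclearNorm_eq_sum_norm]
  refine Finset.sum_le_sum fun k _ => (real_inner_le_norm _ _).trans ?_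
  refine mul_le_of_le_one_left (norm_nonneg _) ?_
  simpa using (toCLM M).le_of_opNorm_le hM (rightSingular F k)

/-- The maximiser is the partial isometry in the polar decomposition of `F`. Where `w k = 0`, the
convention `0⁻¹ = 0` supplies the zero vector. -/
theorem exists_trace_tmul_eq_nuclearNorm (F : Fin p → H) :
    ∃ M : Fin p → H, ‖toCLM M‖ ≤ 1 ∧ (tmul M F).trace = nuclearNorm F := by
  set w : Fin p → H := fun k => toCLM F (rightSingular F k) with hw
  refine ⟨rankOneSum (fun k => ‖w k‖⁻¹ • w k) (rightSingular F),
    norm_rankOneSum_le_one _ _ (rightSingular F).orthonormal ?_ ?_, ?_⟩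
  · intro i j hij
    rw [inner_smul_left, inner_smul_right, hw, inner_toCLM_rightSingular, if_neg hij]
    simp
  · intro i
    rw [norm_smul, norm_inv, norm_norm]
    exact inv_mul_le_one
  · refine (congrArg (fun G => (tmul _ G).trace) (eq_rankOneSum F (rightSingular F))).trans ?_
    rw [trace_tmul_rankOneSum, nuclearNorm_eq_sum_norm]
    refine Finset.sum_congr rfl fun k _ => ?_
    rw [toCLM_rankOneSum, Finset.sum_eq_single k]
    · rw [(rightSingular F).inner_eq_ite]
      simp only [if_true, one_smul]
      change ⟪‖w k‖⁻¹ • w k, w k⟫ = ‖w k‖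
      rw [real_inner_smul_left, real_inner_self_eq_norm_sq]
      by_cases h : ‖w k‖ = 0
      · simp [h]
      · field_simp
    · intro j _ hj
      rw [(rightSingular F).inner_eq_ite, if_neg hj, zero_smul]
    · simp

theorem trace_tmul_add_smul (M F G : Fin p → H) (a b : ℝ) :
    (tmul M (a • F + b • G)).trace = a * (tmul M F).trace + b * (tmul M G).trace := by
  simp [trace_tmul, inner_add_right, real_inner_smul_right, Finset.sum_add_distrib,
    Finset.mul_sum]

/-- The linear functional `F ↦ Tr(Mᵀ F)`. -/
def traceForm (M : Fin p → H) : (Fin p → H) →ₗ[ℝ] ℝ where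
  toFun F := (tmul M F).trace
  map_add' F G := by simpa using trace_tmul_add_smul M F G 1 1
  map_smul' a F := by simpa using trace_tmul_add_smul M F 0 a 0

/-- The nuclear norm is a maximum of linear functionals; the one attaining it at the convex
combination is tested at both endpoints. -/
theorem convexOn_nuclearNorm :
    ConvexOn ℝ Set.univ (nuclearNorm : (Fin p → H) → ℝ) := by
  refine ⟨convex_univ, fun F _ G _ a b ha hb _ => ?_⟩
  obtain ⟨M, hM, h⟩ := exists_trace_tmul_eq_nuclearNorm (a • F + b • G)
  rw [← h, trace_tmul_add_smul, smul_eq_mul, smul_eq_mul]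
  gcongr
  · exact trace_tmul_le_nuclearNorm M F hM
  · exact trace_tmul_le_nuclearNorm M G hM

theorem nuclearNorm_smul_le (F : Fin p → H) {t : ℝ} (ht : 0 ≤ t) :
    nuclearNorm (t • F) ≤ t * nuclearNorm F := by
  obtain ⟨M, hM, h⟩ := exists_trace_tmul_eq_nuclearNorm (t • F)
  have := trace_tmul_add_smul M F 0 t 0
  simp only [smul_zero, add_zero, zero_mul] at this
  rw [← h, this]
  exact mul_le_mul_of_nonneg_left (trace_tmul_le_nuclearNorm M F hM) ht

theorem nuclearNorm_zero : nuclearNorm (0 : Fin p → H) = 0 :=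
  le_antisymm (by simpa using nuclearNorm_smul_le (0 : Fin p → H) le_rfl) (nuclearNorm_nonneg _)

/-- Test on the rank-one matrix `(M x) xᵀ`: its pairing with `M` is `‖M x‖²` and its nuclear norm is
at most `‖x‖ ‖M x‖`. -/
theorem norm_toCLM_le_one_of_trace_le (M : Fin p → H)
    (h : ∀ F, (tmul M F).trace ≤ nuclearNorm F) : ‖toCLM M‖ ≤ 1 := by
  refine ContinuousLinearMap.opNorm_le_bound _ zero_le_one fun x => ?_
  set F := rankOneSum (fun _ : Unit => toCLM M x) (fun _ => x)
  obtain ⟨N, hN, hF⟩ := exists_trace_tmul_eq_nuclearNorm F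
  have h1 := h F
  rw [← hF, trace_tmul_rankOneSum, trace_tmul_rankOneSum] at h1
  simp only [Finset.univ_unique, Finset.sum_singleton, real_inner_self_eq_norm_sq] at h1
  have h2 : ‖toCLM M x‖ ^ 2 ≤ ‖x‖ * ‖toCLM M x‖ :=
    h1.trans ((real_inner_le_norm _ _).trans
      (mul_le_mul_of_nonneg_right (by simpa using (toCLM N).le_of_opNorm_le hN x)
        (norm_nonneg _)))
  by_cases h0 : ‖toCLM M x‖ = 0
  · rw [h0]; positivity
  · have : 0 < ‖toCLM M x‖ := lt_of_le_of_ne (norm_nonneg _) (Ne.symm h0)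
    rw [one_mul]
    nlinarith

end NuclearNorm

/-! ### The equality case along a compact singular value decomposition. -/

section SVD

variable {H : Type*} [NormedAddCommGroup H] [InnerProductSpace ℝ H] {p r : ℕ}
  {A : Fin p → H} {U₁ : Fin r → H} {σ : Fin r → ℝ} {V₁ : Matrix (Fin p) (Fin r) ℝ}

theorem IsCompactSVD.orthonormal_left (h : IsCompactSVD A U₁ σ V₁) : Orthonormal ℝ U₁ := by
  rw [orthonormal_iff_ite]
  intro i j
  simpa [tmul, Matrix.one_apply] using congrFun (congrFun h.left_orthonormal i) j

theorem IsCompactSVD.orthonormal_right (h : IsCompactSVD A U₁ σ V₁) :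
    Orthonormal ℝ fun j => WithLp.toLp 2 (V₁.col j) := by
  rw [orthonormal_iff_ite]
  intro i j
  simpa [PiLp.inner_apply, Matrix.mul_apply, Matrix.one_apply, mul_comm] using
    congrFun (congrFun h.right_orthonormal i) j

theorem IsCompactSVD.eq_rankOneSum (h : IsCompactSVD A U₁ σ V₁) :
    A = rankOneSum (fun j => σ j • U₁ j) fun j => WithLp.toLp 2 (V₁.col j) := by
  funext k
  rw [h.eq_mul]
  simp [rmul, rankOneSum, smul_smul, mul_comm]

/-- Pairing `A` with `U₁ V₁ᵀ` yields `∑ σⱼ`. This inequality suffices, so the `σⱼ` never have to be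
matched with the eigenvalues of `Aᵀ A`. -/
theorem IsCompactSVD.sum_le_nuclearNorm (h : IsCompactSVD A U₁ σ V₁) :
    ∑ j, σ j ≤ nuclearNorm A := by
  have hM : ‖toCLM (rankOneSum U₁ fun j => WithLp.toLp 2 (V₁.col j))‖ ≤ 1 :=
    norm_rankOneSum_le_one _ _ h.orthonormal_right (fun i j hij => h.orthonormal_left.2 hij)
      fun i => (h.orthonormal_left.1 i).le
  refine le_trans (le_of_eq ?_) (trace_tmul_le_nuclearNorm _ A hM)
  rw [h.eq_rankOneSum, trace_tmul_rankOneSum]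
  refine Finset.sum_congr rfl fun k _ => ?_
  rw [toCLM_rankOneSum, Finset.sum_eq_single k]
  · rw [orthonormal_iff_ite.1 h.orthonormal_right, if_pos rfl, one_smul, real_inner_smul_right,
      real_inner_self_eq_norm_sq, h.orthonormal_left.1]
    simp
  · intro j _ hj
    rw [orthonormal_iff_ite.1 h.orthonormal_right, if_neg hj, zero_smul]
  · simp

/-- A matrix of spectral norm at most one that attains the nuclear norm of `A` maps the right
singular vectors of `A` to the left ones. -/
theorem IsCompactSVD.toCLM_right_eq_left (h : IsCompactSVD A U₁ σ V₁) {M : Fin p → H}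
    (hM : ‖toCLM M‖ ≤ 1) (htr : nuclearNorm A ≤ (tmul M A).trace) (k : Fin r) :
    toCLM M (WithLp.toLp 2 (V₁.col k)) = U₁ k := by
  have hMv : ∀ j, ‖toCLM M (WithLp.toLp 2 (V₁.col j))‖ ≤ 1 := fun j => by
    simpa [h.orthonormal_right.1 j] using
      (toCLM M).le_of_opNorm_le hM (WithLp.toLp 2 (V₁.col j))
  have hle : ∀ j, ⟪toCLM M (WithLp.toLp 2 (V₁.col j)), U₁ j⟫ ≤ 1 := fun j =>
    (real_inner_le_norm _ _).trans (by rw [h.orthonormal_left.1 j, mul_one]; exact hMv j)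
  have h1 : ∑ j, σ j ≤ ∑ j, σ j * ⟪toCLM M (WithLp.toLp 2 (V₁.col j)), U₁ j⟫ := by
    refine h.sum_le_nuclearNorm.trans (htr.trans (le_of_eq ?_))
    conv_lhs => rw [h.eq_rankOneSum]
    simp [trace_tmul_rankOneSum, real_inner_smul_right]
  have h2 : ∀ j ∈ Finset.univ, σ j * ⟪toCLM M (WithLp.toLp 2 (V₁.col j)), U₁ j⟫ ≤ σ j :=
    fun j _ => mul_le_of_le_one_right (h.pos j).le (hle j)
  have h3 := (Finset.sum_eq_sum_iff_of_le h2).1 (le_antisymm (Finset.sum_le_sum h2) h1) k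
    (Finset.mem_univ k)
  have h4 : ⟪toCLM M (WithLp.toLp 2 (V₁.col k)), U₁ k⟫ = 1 :=
    mul_left_cancel₀ (h.pos k).ne' (by rw [h3, mul_one])
  -- With `v` the `k`-th column of `V₁`: `‖M v - U₁ k‖² = ‖M v‖² - 2 + 1 ≤ 0`.
  rw [← sub_eq_zero, ← norm_eq_zero, ← sq_eq_zero_iff]
  refine le_antisymm ?_ (sq_nonneg _)
  rw [norm_sub_sq_real, h4, h.orthonormal_left.1 k]
  have := pow_le_one₀ (n := 2) (norm_nonneg _) (hMv k)
  linarith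

end SVD

/-! ### Lagrange multipliers and strong duality. -/

section Duality

/-- Existence of Lagrange multipliers (Fenchel duality) for a finite-dimensional constraint. -/
theorem exists_multiplier {X : Type*} [AddCommGroup X] [Module ℝ X] {n : ℕ}
    {N : X → ℝ} (hN : ConvexOn ℝ Set.univ N) (g : X →ₗ[ℝ] (Fin n → ℝ))
    {L : (Fin n → ℝ) → ℝ} (hL : ConvexOn ℝ Set.univ L) (hLc : Continuous L)
    {P : ℝ} (hP : ∀ A, P ≤ N A + L (g A)) :
    ∃ α : Fin n → ℝ, ∀ A ξ, P ≤ N A + L ξ + ∑ i, α i * (ξ i - g A i) := by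
  -- Strict epigraph of the perturbed value function `w ↦ inf_A (N A + L (g A - w))`. Strictness and
  -- continuity of `L` make it open, whatever the regularity of `N`.
  let S : Set ((Fin n → ℝ) × ℝ) := {q | ∃ A, N A + L (g A - q.1) < q.2}
  have hSo : IsOpen S := by
    have : S = ⋃ A, {q | N A + L (g A - q.1) < q.2} := by ext; simp [S]
    rw [this]
    exact isOpen_iUnion fun A => isOpen_lt (by fun_prop) (by fun_prop)
  have hSc : Convex ℝ S := by
    rintro ⟨w, t⟩ ⟨A, hA⟩ ⟨w', t'⟩ ⟨B, hB⟩ a b ha hb hab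
    refine ⟨a • A + b • B, ?_⟩
    have h1 := hN.2 (Set.mem_univ A) (Set.mem_univ B) ha hb hab
    have h2 := hL.2 (Set.mem_univ (g A - w)) (Set.mem_univ (g B - w')) ha hb hab
    have h3 : g (a • A + b • B) - (a • w + b • w') = a • (g A - w) + b • (g B - w') := by
      simp only [map_add, map_smul, smul_sub]
      abel
    simp only [Prod.fst_add, Prod.smul_fst, Prod.snd_add, Prod.smul_snd, h3, smul_eq_mul] at *
    have h4 : a * (N A + L (g A - w)) + b * (N B + L (g B - w')) < a * t + b * t' := by
      rcases ha.eq_or_lt with rfl | ha'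
      · obtain rfl : b = 1 := by linarith
        simpa using hB
      · have := mul_lt_mul_of_pos_left hA ha'
        have := mul_le_mul_of_nonneg_left hB.le hb
        linarith
    linarith
  have hS0 : ((0 : Fin n → ℝ), P) ∉ S := by
    rintro ⟨A, hA⟩
    simp only [sub_zero] at hA
    exact absurd (hP A) (not_le.2 hA)
  obtain ⟨f, hf⟩ := geometric_hahn_banach_open_point hSc hSo hS0
  set γ : ℝ := f (0, 1) with hγ
  have hf_eq : ∀ (w : Fin n → ℝ) (t : ℝ),
      f (w, t) = (∑ i, w i * f (Pi.single i 1, 0)) + t * γ := by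
    intro w t
    have h1 : (w, t) = (w, (0 : ℝ)) + t • ((0 : Fin n → ℝ), (1 : ℝ)) := by simp
    have h2 := LinearMap.pi_apply_eq_sum_univ
      ((f : ((Fin n → ℝ) × ℝ) →ₗ[ℝ] ℝ).comp (LinearMap.inl ℝ (Fin n → ℝ) ℝ)) w
    have h3 : ∀ i : Fin n, (fun j => if i = j then (1 : ℝ) else 0) = Pi.single i 1 := by
      intro i; ext j; simp [Pi.single_apply, eq_comm]
    simp only [h3, LinearMap.comp_apply, LinearMap.inl_apply, ContinuousLinearMap.coe_coe,
      smul_eq_mul] at h2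
    rw [h1, map_add, map_smul, h2, smul_eq_mul]
  -- The separating hyperplane is not vertical: `S` contains a point `(0, t)` with `t > P`.
  have hγneg : γ < 0 := by
    have := hf (0, max (N 0 + L (g 0)) P + 1)
      ⟨0, by simpa using (le_max_left (N 0 + L (g 0)) P).trans_lt (lt_add_one _)⟩
    rw [hf_eq, hf_eq] at this
    have hm := le_max_right (N 0 + L (g 0)) P
    simp only [Pi.zero_apply, zero_mul, Finset.sum_const_zero, zero_add] at this
    by_contra hcon
    nlinarith
  refine ⟨fun i => -f (Pi.single i 1, 0) / γ, fun A ξ => ?_⟩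
  refine le_of_forall_pos_le_add fun ε hε => ?_
  -- The perturbation `w = g A - ξ` turns `L (g A - w)` into `L ξ`; `ε` is there because `S` omits
  -- its lower boundary.
  have h := hf (g A - ξ, N A + L ξ + ε) ⟨A, by simpa using hε⟩
  rw [hf_eq, hf_eq] at h
  have hsum : γ * ∑ i, -f (Pi.single i 1, 0) / γ * (ξ i - g A i) =
      ∑ i, (g A - ξ) i * f (Pi.single i 1, 0) := by
    rw [Finset.mul_sum]
    refine Finset.sum_congr rfl fun i _ => ?_
    have := hγneg.ne
    simp only [Pi.sub_apply]
    field_simp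
    ring
  rw [← hsum] at h
  simp only [Pi.zero_apply, zero_mul, Finset.sum_const_zero, zero_add] at h
  by_contra hcon
  nlinarith

/-- Varying one coordinate with the others at 0 shows that each supremum is a real number;
near-maximisers are then chosen independently in each coordinate. -/
theorem sum_iSup_coe_le {ι : Type*} [Fintype ι] (f : ι → ℝ → ℝ) (B : ℝ)
    (h : ∀ ξ : ι → ℝ, ∑ i, f i (ξ i) ≤ B) :
    ∑ i, ⨆ t : ℝ, ((f i t : ℝ) : EReal) ≤ B := by
  classical
  have hbdd : ∀ i, BddAbove (Set.range (f i)) := by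
    intro i
    refine ⟨B - ∑ j ∈ Finset.univ.erase i, f j 0, ?_⟩
    rintro _ ⟨t, rfl⟩
    have := h (Function.update 0 i t)
    rw [← Finset.add_sum_erase _ _ (Finset.mem_univ i)] at this
    have h2 : ∑ j ∈ Finset.univ.erase i, f j (Function.update (0 : ι → ℝ) i t j) =
        ∑ j ∈ Finset.univ.erase i, f j 0 :=
      Finset.sum_congr rfl fun j hj => by simp [Finset.ne_of_mem_erase hj]
    rw [h2, Function.update_self] at this
    linarith
  have hle : ∑ i, (⨆ t : ℝ, ((f i t : ℝ) : EReal)) ≤ ∑ i, ((⨆ t, f i t : ℝ) : EReal) :=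
    Finset.sum_le_sum fun i _ => iSup_le fun t => EReal.coe_le_coe_iff.2 (le_ciSup (hbdd i) t)
  refine hle.trans ?_
  have hcoe : ∑ i, ((⨆ t, f i t : ℝ) : EReal) = ((∑ i, ⨆ t, f i t : ℝ) : EReal) :=
    (map_sum (⟨⟨Real.toEReal, EReal.coe_zero⟩, EReal.coe_add⟩ : ℝ →+ EReal) _ _).symm
  rw [hcoe, EReal.coe_le_coe_iff]
  refine le_of_forall_pos_le_add fun ε hε => ?_
  -- The `+ 1` covers empty `ι`.
  have hδ : 0 < ε / (Fintype.card ι + 1) := by positivity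
  choose ξ hξ using fun i => exists_lt_of_lt_ciSup (sub_lt_self (⨆ t, f i t) hδ)
  have h1 : ∑ i, ((⨆ t, f i t) - ε / (Fintype.card ι + 1)) ≤ ∑ i, f i (ξ i) :=
    Finset.sum_le_sum fun i _ => (hξ i).le
  rw [Finset.sum_sub_distrib, Finset.sum_const, nsmul_eq_mul, Finset.card_univ] at h1
  have h2 : (Fintype.card ι : ℝ) * (ε / (Fintype.card ι + 1)) ≤ ε := by
    rw [mul_div_assoc', div_le_iff₀ (by positivity)]
    nlinarith
  linarith [h ξ]

variable {H : Type*} [NormedAddCommGroup H] [InnerProductSpace ℝ H] {p n : ℕ}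

/-- The dual objective is the infimum over `ξ` of `c ∑ ℓ(ξᵢ) + ∑ αᵢ ξᵢ`, because this Lagrangian
term is separable. -/
theorem coe_le_dualObjective {c : ℝ} (hc : 0 < c) {ℓ : ℝ → ℝ} {α : Fin n → ℝ} {P : ℝ}
    (h : ∀ ξ : Fin n → ℝ, P ≤ c * ∑ i, ℓ (ξ i) + ∑ i, α i * ξ i) :
    (P : EReal) ≤ dualObjective c ℓ α := by
  have h1 : ∑ i, fenchelConj ℓ (-(α i / c)) ≤ ((-(P / c) : ℝ) : EReal) := by
    refine sum_iSup_coe_le (fun i t => -(α i / c) * t - ℓ t) _ fun ξ => ?_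
    have h2 : ∑ i, (-(α i / c) * ξ i - ℓ (ξ i)) =
        -((c * ∑ i, ℓ (ξ i) + ∑ i, α i * ξ i) / c) := by
      rw [Finset.sum_sub_distrib, add_div, mul_div_cancel_left₀ _ hc.ne', Finset.sum_div, neg_add,
        ← Finset.sum_neg_distrib (f := fun i => α i * ξ i / c), sub_eq_add_neg, add_comm]
      congr 1
      exact Finset.sum_congr rfl fun i _ => by ring
    rw [h2]
    exact neg_le_neg (div_le_div_of_nonneg_right (h ξ) hc.le)
  rw [dualObjective, EReal.le_neg]
  refine (mul_le_mul_of_nonneg_left h1 (EReal.coe_nonneg.2 hc.le)).trans (le_of_eq ?_)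
  rw [← EReal.coe_mul, ← EReal.coe_neg, EReal.coe_eq_coe_iff]
  field_simp

/-- Fenchel–Young inequality, summed over the samples. -/
theorem dualObjective_le_coe {c : ℝ} (hc : 0 < c) (ℓ : ℝ → ℝ) (α ξ : Fin n → ℝ) :
    dualObjective c ℓ α ≤ ((c * ∑ i, ℓ (ξ i) + ∑ i, α i * ξ i : ℝ) : EReal) := by
  have h1 : ((∑ i, (-(α i / c) * ξ i - ℓ (ξ i)) : ℝ) : EReal) ≤
      ∑ i, fenchelConj ℓ (-(α i / c)) := by
    have hcoe := map_sum (⟨⟨Real.toEReal, EReal.coe_zero⟩, EReal.coe_add⟩ : ℝ →+ EReal)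
      (fun i => -(α i / c) * ξ i - ℓ (ξ i)) Finset.univ
    refine (le_of_eq hcoe).trans (Finset.sum_le_sum fun i _ => ?_)
    exact le_iSup (fun t : ℝ => ((-(α i / c) * t - ℓ t : ℝ) : EReal)) (ξ i)
  rw [dualObjective, EReal.neg_le]
  refine le_trans (le_of_eq ?_) (mul_le_mul_of_nonneg_left h1 (EReal.coe_nonneg.2 hc.le))
  have h2 : ∑ i, α i * ξ i = -(c * ∑ i, -(α i / c) * ξ i) := by
    rw [Finset.mul_sum, ← Finset.sum_neg_distrib]
    refine Finset.sum_congr rfl fun i _ => ?_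
    field_simp
  rw [← EReal.coe_mul, ← EReal.coe_neg, EReal.coe_eq_coe_iff, Finset.sum_sub_distrib, h2]
  ring

theorem trace_tmul_sum_smul (Φ : Fin n → Fin p → H) (a : Fin n → ℝ) (F : Fin p → H) :
    (tmul (∑ i, a i • Φ i) F).trace = ∑ i, a i * (tmul (Φ i) F).trace := by
  simp only [trace_tmul, Finset.sum_apply, Pi.smul_apply, sum_inner, real_inner_smul_left,
    Finset.mul_sum]
  rw [Finset.sum_comm]

theorem nonneg_of_forall_le_mul_add {a b : ℝ} (h : ∀ t : ℝ, 0 ≤ t → 0 ≤ t * a + b) : 0 ≤ a := by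
  by_contra! hcon
  have h1 := h ((|b| + 1) / -a) (div_nonneg (by positivity) (by linarith))
  have h2 : (|b| + 1) / -a * a = -(|b| + 1) := by
    have := hcon.ne
    field_simp
  have := le_abs_self b
  linarith

/-- Strong duality: the dual problem has a feasible point whose value is at least the optimal value
of the primal problem. -/
theorem IsPrimalOptimal.exists_dualFeasible {Φ : Fin n → Fin p → H} {y : Fin n → ℝ} {c : ℝ}
    (hc : 0 < c) {ℓ : ℝ → ℝ} (hconv : ConvexOn ℝ Set.univ ℓ) (hanti : Antitone ℓ)
    {A : Fin p → H} {ξ : Fin n → ℝ} (hA : IsPrimalOptimal Φ y c ℓ A ξ) :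
    ∃ α ∈ dualFeasible Φ y, (primalObjective c ℓ (A, ξ) : EReal) ≤ dualObjective c ℓ α := by
  have hℓc : Continuous ℓ := by
    rw [← continuousOn_univ]
    exact hconv.continuousOn isOpen_univ
  let g : (Fin p → H) →ₗ[ℝ] (Fin n → ℝ) := LinearMap.pi fun i => y i • traceForm (Φ i)
  have hg : ∀ F i, g F i = y i * (tmul (Φ i) F).trace := fun F i => rfl
  have hL : ConvexOn ℝ Set.univ fun η : Fin n → ℝ => c * ∑ i, ℓ (η i) := by
    refine ⟨convex_univ, fun u _ v _ a b ha hb hab => ?_⟩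
    have h : ∑ i, ℓ ((a • u + b • v) i) ≤ ∑ i, (a * ℓ (u i) + b * ℓ (v i)) :=
      Finset.sum_le_sum fun i _ => by
        simpa using hconv.2 (Set.mem_univ (u i)) (Set.mem_univ (v i)) ha hb hab
    rw [Finset.sum_add_distrib, ← Finset.mul_sum, ← Finset.mul_sum] at h
    have := mul_le_mul_of_nonneg_left h hc.le
    simp only [smul_eq_mul]
    linarith
  -- The choice `ξ = g F` makes every constraint tight and eliminates `ξ`.
  have hP : ∀ F, primalObjective c ℓ (A, ξ) ≤ nuclearNorm F + c * ∑ i, ℓ (g F i) := fun F =>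
    isMinOn_iff.1 hA.2 (F, g F) fun i => (hg F i).le
  generalize primalObjective c ℓ (A, ξ) = P at hP ⊢
  obtain ⟨α, hα⟩ := exists_multiplier convexOn_nuclearNorm g hL (by fun_prop) hP
  have hzero : ∀ η : Fin n → ℝ, P ≤ c * ∑ i, ℓ (η i) + ∑ i, α i * η i := by
    intro η
    simpa [nuclearNorm_zero] using hα 0 η
  refine ⟨α, ⟨?_, fun i => ?_⟩, coe_le_dualObjective hc hzero⟩
  -- With `ξ = 0` and `F` scaled by `t → ∞`, the multiplier inequality forces `‖F‖_* - Tr(Mᵀ F) ≥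
  -- 0`, where `M = ∑ αᵢ yᵢ Φᵢ`.
  · refine norm_toCLM_le_one_of_trace_le _ fun F => ?_
    rw [trace_tmul_sum_smul]
    refine sub_nonneg.1 (nonneg_of_forall_le_mul_add (b := c * ∑ i : Fin n, ℓ 0 - P)
      fun t ht => ?_)
    have h1 := hα (t • F) 0
    have h2 := nuclearNorm_smul_le F ht
    have h3 : ∑ i, α i * ((0 : Fin n → ℝ) i - g (t • F) i) =
        -(t * ∑ i, α i * y i * (tmul (Φ i) F).trace) := by
      rw [Finset.mul_sum, ← Finset.sum_neg_distrib]
      refine Finset.sum_congr rfl fun i _ => ?_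
      rw [map_smul, Pi.smul_apply, hg, smul_eq_mul, Pi.zero_apply]
      ring
    rw [h3] at h1
    simp only [Pi.zero_apply] at h1
    linarith
  -- Raising `ξᵢ` to `t ≥ 0` cannot increase the loss, so `αᵢ t` stays bounded below.
  · refine nonneg_of_forall_le_mul_add (b := c * ∑ i : Fin n, ℓ 0 - P) fun t ht => ?_
    have h1 := hzero (Pi.single i t)
    have h2 : ∑ j, ℓ ((Pi.single i t : Fin n → ℝ) j) ≤ ∑ j : Fin n, ℓ 0 :=
      Finset.sum_le_sum fun j _ => hanti ((Pi.single_nonneg.2 ht : (0 : Fin n → ℝ) ≤ _) j)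
    have h3 : ∑ j, α j * (Pi.single i t : Fin n → ℝ) j = α i * t := by
      simp [Pi.single_apply]
    have h5 := mul_le_mul_of_nonneg_left h2 hc.le
    rw [h3] at h1
    linarith

/-- Complementary slackness: an optimal dual matrix attains the nuclear norm of an optimal primal
one. -/
theorem IsDualOptimal.nuclearNorm_le_trace {Φ : Fin n → Fin p → H} {y : Fin n → ℝ} {c : ℝ}
    (hc : 0 < c) {ℓ : ℝ → ℝ} (hconv : ConvexOn ℝ Set.univ ℓ) (hanti : Antitone ℓ)
    {A : Fin p → H} {ξ : Fin n → ℝ} (hA : IsPrimalOptimal Φ y c ℓ A ξ)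
    {α : Fin n → ℝ} (hα : IsDualOptimal Φ y c ℓ α) :
    nuclearNorm A ≤ (tmul (∑ i, (α i * y i) • Φ i) A).trace := by
  obtain ⟨β, hβ, hle⟩ := hA.exists_dualFeasible hc hconv hanti
  -- Both ends of this chain through the dual values of `β` and `α` are real and contain `c ∑
  -- ℓ(ξᵢ)`, which cancels to leave `‖A‖_* ≤ ∑ αᵢ ξᵢ`.
  have h := EReal.coe_le_coe_iff.1
    (hle.trans ((hα.2 hβ).trans (dualObjective_le_coe hc ℓ α ξ)))
  rw [primalObjective] at h
  have h2 : ∑ i, α i * ξ i ≤ ∑ i, α i * y i * (tmul (Φ i) A).trace :=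
    Finset.sum_le_sum fun i _ => by
      rw [mul_assoc]
      exact mul_le_mul_of_nonneg_left (hA.1 i) (hα.1.2 i)
  rw [trace_tmul_sum_smul]
  simp only at h
  linarith

end Duality

end DCCNN

theorem theorem3 {H : Type*} [NormedAddCommGroup H] [InnerProductSpace ℝ H]
    {d₀ d₁ p n r : ℕ}
    (φ : (Fin d₁ → ℝ) → H) (z : Fin p → (Fin d₀ → ℝ) → (Fin d₁ → ℝ))
    (x : Fin n → (Fin d₀ → ℝ)) (y : Fin n → ℝ)
    (c : ℝ) (hc : 0 < c) (ℓ : ℝ → ℝ) (hconv : ConvexOn ℝ Set.univ ℓ) (hanti : Antitone ℓ)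
    (A : Fin p → H) (ξ : Fin n → ℝ)
    (hA : DCCNN.IsPrimalOptimal (fun i => DCCNN.basisMatrix φ z (x i)) y c ℓ A ξ)
    (U₁ : Fin r → H) (σ : Fin r → ℝ) (V₁ : Matrix (Fin p) (Fin r) ℝ)
    (hsvd : DCCNN.IsCompactSVD A U₁ σ V₁)
    (α : Fin n → ℝ)
    (hα : DCCNN.IsDualOptimal (fun i => DCCNN.basisMatrix φ z (x i)) y c ℓ α) :
    ∀ i, DCCNN.tmul (DCCNN.basisMatrix φ z (x i)) U₁ =
      ∑ j, (α j * y j) •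
        (DCCNN.kernelMatrix (DCCNN.kernelFun φ) z (x i) (x j) * V₁) := by
  intro i
  -- Columnwise form of `U₁ = M V₁`; the rest expands `Φ(xᵢ)ᵀ M V₁` in kernel entries.
  have hU := hsvd.toCLM_right_eq_left hα.1.1 (hα.nuclearNorm_le_trace hc hconv hanti hA)
  ext k l
  have hl : inner ℝ (φ (z k (x i))) (U₁ l) =
      ∑ m, V₁ m l * ∑ j, α j * y j * inner ℝ (φ (z k (x i))) (φ (z m (x j))) := by
    rw [← hU l, DCCNN.toCLM_apply, inner_sum]
    simp [Finset.sum_apply, inner_sum, real_inner_smul_right, DCCNN.basisMatrix]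
  simp only [DCCNN.tmul, DCCNN.basisMatrix, Matrix.of_apply, hl, Matrix.sum_apply,
    Matrix.smul_apply, Matrix.mul_apply, DCCNN.kernelMatrix, DCCNN.kernelFun, smul_eq_mul,
    Finset.mul_sum]
  rw [Finset.sum_comm]
  exact Finset.sum_congr rfl fun _ _ => Finset.sum_congr rfl fun _ _ => by ring
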